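/- Let $\chi_A,\chi_B,\chi_C\ge 1$ be integers with $\chi_A\chi_B\le\chi_C$, let $\mathcal H_A,\mathcal H_B,\mathcal H_C$ be Hilbert spaces of these dimensions, let $|\psi\rangle=U|\phi_0\rangle$ be a Haar-random tripartite state, where $|\phi_0\rangle\in\mathcal H_A\otimes\mathcal H_B\otimes\mathcal H_C$ is a fixed unit vector and $U$ is a Haar-distributed unitary on $\mathcal H_A\otimes\mathcal H_B\otimes\mathcal H_C$, and let $\rho_{AB}=\operatorname{Tr}_C|\psi\rangle\langle\psi|$. For real $m>0$ regard $\rho_{AB}^{m/2}$ as a vector $|\rho_{AB}^{m/2}\rangle$ of $(\mathcal H_A\otimes\mathcal H_A^*)\otimes(\mathcal H_B\otimes\mathcal H_B^*)$ with the Hilbert--Schmidt inner product, and put $$\rho^{(m)}_{AA^*}=\frac{1}{\operatorname{Tr}\rho_{AB}^m}\operatorname{Tr}_{BB^*}|\rho_{AB}^{m/2}\rangle\langle\rho_{AB}^{m/2}|.$$ The $(m,n)$-Rényi reflected entropy is $S_R^{(m,n)}(A:B)=-\frac1{n-1}\ln\operatorname{Tr}\big(\rho^{(m)}_{AA^*}\big)^n$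 for real $n>1$, and $S_R^{(m,1)}(A:B)=-\operatorname{Tr}\big(\rho^{(m)}_{AA^*}\ln\rho^{(m)}_{AA^*}\big)$. Let the overline denote the average over $U$. Then, for every real $m$ with $1\le m\le 2$ and every real $n>1$, $$\overline{S_R^{(m,n)}(A:B)}\le\frac{2n}{n-1}\left(\frac{\chi_A\chi_B}{\chi_C}\right)^{1/2}\min\{\chi_A^{2(n-1)},\chi_B^{2(n-1)}\},$$ and, for every real $m$ with $1\le m\le 2$, $$\overline{S_R^{(m,1)}(A:B)}\le 2\left(\frac{\chi_A\chi_B}{\chi_C}\right)^{1/2}\min\{\ln\chi_A,\ln\chi_B\}+\ln 2.$$ -/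

import Mathlib

open MeasureTheory Matrix

/-! ### Haar measure on the unitary group -/

noncomputable instance unitaryGroupMeasurableSpace (ι : Type*) [Fintype ι] [DecidableEq ι] :
    MeasurableSpace (Matrix.unitaryGroup ι ℂ) := borel _

instance unitaryGroupBorelSpace (ι : Type*) [Fintype ι] [DecidableEq ι] :
    BorelSpace (Matrix.unitaryGroup ι ℂ) := ⟨rfl⟩

instance unitaryGroupCompactSpace (ι : Type*) [Fintype ι] [DecidableEq ι] :
    CompactSpace (Matrix.unitaryGroup ι ℂ) := by
  have hK : IsCompact (Set.univ.pi fun _ : ι => Set.univ.pi fun _ : ι =>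
      Metric.closedBall (0 : ℂ) 1) :=
    isCompact_univ_pi fun _ => isCompact_univ_pi fun _ => isCompact_closedBall _ _
  have hclosed : IsClosed (Matrix.unitaryGroup ι ℂ : Set (Matrix ι ι ℂ)) := by
    have h : (Matrix.unitaryGroup ι ℂ : Set (Matrix ι ι ℂ)) = {U | star U * U = 1} := by
      ext U
      exact Matrix.mem_unitaryGroup_iff'
    rw [h]
    exact isClosed_eq (continuous_star.mul continuous_id) continuous_const
  refine isCompact_iff_compactSpace.mp (hK.of_isClosed_subset hclosed ?_)
  intro U hU i _ j _
  simpa using entry_norm_bound_of_unitary hU i j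

/-- The Haar probability measure on the unitary group of `ℂ^ι` (total mass one). -/
noncomputable def haarUnitary (ι : Type*) [Fintype ι] [DecidableEq ι] :
    Measure (Matrix.unitaryGroup ι ℂ) :=
  Measure.haarMeasure ⊤

/-- The state `U |φ₀⟩` obtained by acting with the unitary `U` on the anchor state `|φ₀⟩`;
it is a Haar-random state when `U` is distributed according to `haarUnitary ι`. -/
noncomputable def rotatedState {ι : Type*} [Fintype ι] [DecidableEq ι]
    (φ₀ : EuclideanSpace ℂ ι) (U : Matrix.unitaryGroup ι ℂ) : EuclideanSpace ℂ ι :=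
  WithLp.toLp 2 ((U : Matrix ι ι ℂ) *ᵥ φ₀.ofLp)

/-! ### Density matrices, partial traces and entropies -/

/-- The rank-one operator `|ψ⟩⟨ψ|`. -/
def ketBra {ι : Type*} (ψ : EuclideanSpace ℂ ι) : Matrix ι ι ℂ :=
  vecMulVec ψ.ofLp (star ψ.ofLp)

/-- The partial trace over the second tensor factor. -/
def partialTraceSnd {ι κ : Type*} [Fintype κ] (M : Matrix (ι × κ) (ι × κ) ℂ) :
    Matrix ι ι ℂ :=
  Matrix.of fun i j => ∑ k, M (i, k) (j, k)

/-- The real power `ρ ^ s`, `s > 0`, of a positive semidefinite matrix, by functional calculus. -/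
noncomputable def matPow {ι : Type*} [Fintype ι] [DecidableEq ι]
    (ρ : Matrix ι ι ℂ) (s : ℝ) : Matrix ι ι ℂ :=
  cfc (fun x : ℝ => x ^ s) ρ

/-- The von Neumann entropy `- Tr (ρ ln ρ)`. -/
noncomputable def vonNeumannEntropy {ι : Type*} [Fintype ι] [DecidableEq ι]
    (ρ : Matrix ι ι ℂ) : ℝ :=
  (cfc Real.negMulLog ρ).trace.re

/-- The Rényi entropy `- (ln Tr ρ ^ n) / (n - 1)` of a density matrix, for `n > 0`; at `n = 1`
it is the von Neumann entropy. -/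
noncomputable def renyiEntropy {ι : Type*} [Fintype ι] [DecidableEq ι]
    (n : ℝ) (ρ : Matrix ι ι ℂ) : ℝ :=
  if n = 1 then vonNeumannEntropy ρ
  else -(1 / (n - 1)) * Real.log (matPow ρ n).trace.re

/-! ### Reflected entropy -/

/-- An operator `X` on `H_A ⊗ H_B`, regarded as a vector `|X⟩` of
`(H_A ⊗ H_A*) ⊗ (H_B ⊗ H_B*)`. -/
def operatorKet {α β : Type*} (X : Matrix (α × β) (α × β) ℂ) :
    EuclideanSpace ℂ ((α × α) × (β × β)) :=
  WithLp.toLp 2 fun p => X (p.1.1, p.2.1) (p.1.2, p.2.2)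

/-- The normalized state `|ψ⁽ᵐ⁾⟩ = (Tr ρ ^ m)^(-1/2) |ρ ^ (m/2)⟩`. For `m = 1` and `Tr ρ = 1` it
is the canonical purification of `ρ`. -/
noncomputable def reflectedKet {α β : Type*} [Fintype α] [DecidableEq α] [Fintype β]
    [DecidableEq β] (m : ℝ) (ρ : Matrix (α × β) (α × β) ℂ) :
    EuclideanSpace ℂ ((α × α) × (β × β)) :=
  (((matPow ρ m).trace.re ^ (-(1 / 2) : ℝ) : ℝ) : ℂ) • operatorKet (matPow ρ (m / 2))

/-- The reduced density matrix `ρ_{AA*}⁽ᵐ⁾ = Tr_{BB*} |ψ⁽ᵐ⁾⟩⟨ψ⁽ᵐ⁾|`. -/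
noncomputable def reflectedDensity {α β : Type*} [Fintype α] [DecidableEq α] [Fintype β]
    [DecidableEq β] (m : ℝ) (ρ : Matrix (α × β) (α × β) ℂ) : Matrix (α × α) (α × α) ℂ :=
  partialTraceSnd (ketBra (reflectedKet m ρ))

/-- The `(m,n)`-Rényi reflected entropy of a density matrix `ρ` on `AB`. -/
noncomputable def renyiReflectedEntropy {α β : Type*} [Fintype α] [DecidableEq α] [Fintype β]
    [DecidableEq β] (m n : ℝ) (ρ : Matrix (α × β) (α × β) ℂ) : ℝ :=
  renyiEntropy n (reflectedDensity m ρ)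

/-- The `(m,n)`-Rényi reflected entropy of a tripartite pure state on `ABC`,
i.e. that of its reduced density matrix `ρ_{AB} = Tr_C |ψ⟩⟨ψ|`. -/
noncomputable def tripartiteReflectedEntropy {α β γ : Type*} [Fintype α] [DecidableEq α]
    [Fintype β] [DecidableEq β] [Fintype γ] (m n : ℝ)
    (ψ : EuclideanSpace ℂ ((α × β) × γ)) : ℝ :=
  renyiReflectedEntropy m n (partialTraceSnd (ketBra ψ))

/-! Write d = χ_A χ_B and let δ = d Tr ρ_AB² - 1 be the excess purity. The proof bounds the entropy
of each state linearly in δ, so averaging needs only the mean purity and no concentration estimate.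

For each state, `exists_one_sub_le_eigenvalues_reflectedDensity` gives an eigenvalue of ρ_{AA*} of
size at least 1 - δ. The trial vector is the product of the maximally entangled vectors on AA* and
BB*, whose squared overlap with the normalized |ρ^{m/2}⟩ is (Tr ρ^{m/2})² / (d Tr ρ^m).
`one_sub_mul_sum_rpow_le_sq` bounds this below by 1 - δ. The rank of ρ_{AA*} is at most r = χ_A² and
at most r = χ_B². A spectrum with these properties has Rényi entropy at most n/(n-1) r^{n-1} δ
(`neg_log_sum_rpow_le`) and von Neumann entropy at most δ ln r + ln 2 (`sum_negMulLog_le`).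

On average, `integral_purityExcess` gives E δ = (d² - 1)/(d χ_C + 1) ≤ d/χ_C, which is at most its
square root because d ≤ χ_C. The fourth moments it needs follow from invariance under phases and one
explicit reflection. -/

section ReflectedEntropyBounds

open scoped ComplexOrder

/-! ### Spectral facts on Hermitian matrices -/

namespace Matrix.IsHermitian

variable {ι : Type*} [Fintype ι] [DecidableEq ι] {A : Matrix ι ι ℂ}

lemma trace_cfc (hA : A.IsHermitian) (f : ℝ → ℝ) :
    (cfc f A).trace = ((∑ i, f (hA.eigenvalues i) : ℝ) : ℂ) := by
  rw [hA.cfc_eq, IsHermitian.cfc, Unitary.conjStarAlgAut_apply, trace_mul_cycle,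
    Unitary.coe_star_mul_self, one_mul, trace_diagonal]
  simp

/-- The quadratic form at a unit vector is an average of the eigenvalues, with weights the squared
coordinates in the eigenbasis. -/
lemma exists_re_dotProduct_le_eigenvalues (hA : A.IsHermitian) {v : ι → ℂ}
    (hv : star v ⬝ᵥ v = 1) : ∃ i, (star v ⬝ᵥ (A *ᵥ v)).re ≤ hA.eigenvalues i := by
  by_contra! h
  set c := (star v ⬝ᵥ (A *ᵥ v)).re with hc
  set U : Matrix ι ι ℂ := (hA.eigenvectorUnitary : Matrix ι ι ℂ)
  set w := star U *ᵥ v with hw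
  have hUU : U * star U = 1 := Unitary.coe_mul_star_self hA.eigenvectorUnitary
  have hwv : star w = star v ᵥ* U := by
    rw [hw, star_mulVec, star_eq_conjTranspose, conjTranspose_conjTranspose]
  have h1 : star w ⬝ᵥ w = 1 := by
    rw [hwv, hw, dotProduct_mulVec, vecMul_vecMul, hUU, vecMul_one, hv]
  have h2 : star v ⬝ᵥ (A *ᵥ v) = ∑ i, ((hA.eigenvalues i * ‖w i‖ ^ 2 : ℝ) : ℂ) := by
    have : A = U * diagonal (RCLike.ofReal ∘ hA.eigenvalues) * star U := by
      conv_lhs => rw [hA.spectral_theorem, Unitary.conjStarAlgAut_apply]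
    conv_lhs => rw [this, mul_assoc, ← mulVec_mulVec, dotProduct_mulVec, ← hwv, ← mulVec_mulVec, ← hw,
      dotProduct]
    refine Finset.sum_congr rfl fun i _ => ?_
    rw [mulVec_diagonal]
    simp only [Pi.star_apply, Function.comp_apply, RCLike.star_def, Complex.ofReal_mul,
      Complex.ofReal_pow, ← Complex.conj_mul', Complex.coe_algebraMap]
    ring
  have h3 : ∑ i, ‖w i‖ ^ 2 = 1 := by
    have : ((∑ i, ‖w i‖ ^ 2 : ℝ) : ℂ) = 1 := by
      rw [← h1, dotProduct]
      push_cast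
      exact Finset.sum_congr rfl fun i _ => by simp [← Complex.conj_mul']
    exact_mod_cast this
  have h4 : c = ∑ i, hA.eigenvalues i * ‖w i‖ ^ 2 := by
    rw [hc, h2, ← Complex.ofReal_sum, Complex.ofReal_re]
  obtain ⟨j, -, hj⟩ : ∃ j ∈ Finset.univ, ‖w j‖ ^ 2 ≠ 0 := by
    apply Finset.exists_ne_zero_of_sum_ne_zero
    rw [h3]
    exact one_ne_zero
  have : ∑ i, hA.eigenvalues i * ‖w i‖ ^ 2 < ∑ i, c * ‖w i‖ ^ 2 := by
    refine Finset.sum_lt_sum (fun i _ => by gcongr; exact (h i).le) ⟨j, Finset.mem_univ j, ?_⟩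
    exact mul_lt_mul_of_pos_right (h j) (lt_of_le_of_ne (by positivity) hj.symm)
  rw [← h4, ← Finset.mul_sum, h3, mul_one] at this
  exact lt_irrefl _ this

end Matrix.IsHermitian

namespace Matrix.PosSemidef

variable {ι : Type*} [Fintype ι] [DecidableEq ι] {A : Matrix ι ι ℂ}

lemma sum_eigenvalues_eq_one (hA : A.PosSemidef) (ht : A.trace = 1) :
    ∑ i, hA.isHermitian.eigenvalues i = 1 := by
  have := hA.isHermitian.trace_eq_sum_eigenvalues
  rw [ht, ← RCLike.ofReal_sum] at this
  exact (Complex.ofReal_eq_one.mp this.symm)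

lemma spectrum_subset_Icc (hA : A.PosSemidef) (ht : A.trace = 1) :
    spectrum ℝ A ⊆ Set.Icc 0 1 := by
  rw [hA.isHermitian.spectrum_real_eq_range_eigenvalues]
  rintro _ ⟨i, rfl⟩
  refine ⟨hA.eigenvalues_nonneg i, ?_⟩
  rw [← hA.sum_eigenvalues_eq_one ht]
  exact Finset.single_le_sum (fun j _ => hA.eigenvalues_nonneg j) (Finset.mem_univ i)

lemma cfc_mul_cfc_eq (hA : A.PosSemidef) {f g h : ℝ → ℝ} (hfg : ∀ x, 0 ≤ x → f x * g x = h x) :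
    cfc f A * cfc g A = cfc h A := by
  have hc (f : ℝ → ℝ) : ContinuousOn f (spectrum ℝ A) :=
    (Matrix.finite_real_spectrum (A := A)).continuousOn f
  rw [← cfc_mul f g A (hc f) (hc g)]
  refine cfc_congr fun x hx => ?_
  rw [hA.isHermitian.spectrum_real_eq_range_eigenvalues] at hx
  obtain ⟨i, rfl⟩ := hx
  exact hfg _ (hA.eigenvalues_nonneg i)

end Matrix.PosSemidef

/-- The spectra all lie in the one compact set [0, 1], which makes the functional calculus
continuous in the matrix. -/
lemma continuous_cfc_of_density {ι X : Type*} [Fintype ι] [DecidableEq ι] [TopologicalSpace X]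
    {f : ℝ → ℝ} (hf : Continuous f) {a : X → Matrix ι ι ℂ} (ha : Continuous a)
    (hpos : ∀ x, (a x).PosSemidef) (htr : ∀ x, (a x).trace = 1) :
    Continuous fun x => cfc f (a x) := by
  open scoped Matrix.Norms.L2Operator in
  refine Continuous.cfc' (s := Set.Icc (0 : ℝ) 1) isCompact_Icc f ha
    (fun x => ?_) hf.continuousOn fun x => ?_
  · exact (hpos x).spectrum_subset_Icc (htr x)
  · exact (hpos x).isHermitian

/-! ### Entropy bounds for probability vectors -/

section ProbabilityVector

variable {κ : Type*} [Fintype κ] {p : κ → ℝ} {r δ n : ℝ}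

/-- Power-mean inequality restricted to the support, so that the rank enters rather than the
dimension. -/
lemma rpow_neg_le_sum_rpow (hp : ∀ i, 0 ≤ p i) (hsum : ∑ i, p i = 1)
    (hr : ((Finset.univ.filter fun i => p i ≠ 0).card : ℝ) ≤ r) (hn : 1 < n) :
    0 < ∑ i, p i ^ n ∧ 1 ≤ r ^ (n - 1) * ∑ i, p i ^ n := by
  set s := Finset.univ.filter fun i => p i ≠ 0 with hs
  have h1 : ∑ i ∈ s, p i = 1 := by rw [hs, Finset.sum_filter_ne_zero, hsum]
  have h2 : ∑ i ∈ s, p i ^ n ≤ ∑ i, p i ^ n :=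
    Finset.sum_le_sum_of_subset_of_nonneg (Finset.subset_univ _)
      fun i _ _ => Real.rpow_nonneg (hp i) n
  have h3 := Real.rpow_sum_le_const_mul_sum_rpow_of_nonneg (s := s) (f := p) hn.le
    fun i _ => hp i
  rw [h1, Real.one_rpow] at h3
  have h0 : 0 ≤ ∑ i, p i ^ n := Finset.sum_nonneg fun i _ => Real.rpow_nonneg (hp i) n
  have h4 : 1 ≤ r ^ (n - 1) * ∑ i, p i ^ n := by
    refine h3.trans (mul_le_mul (Real.rpow_le_rpow (by positivity) hr (by linarith)) h2 ?_ ?_)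
    · exact Finset.sum_nonneg fun i _ => Real.rpow_nonneg (hp i) n
    · exact Real.rpow_nonneg ((Nat.cast_nonneg _).trans hr) _
  refine ⟨lt_of_le_of_ne h0 fun h => ?_, h4⟩
  rw [← h, mul_zero] at h4
  exact absurd h4 (by norm_num)

/-- With T the power sum, -ln T ≤ (1 - T)/T. Bernoulli at the large entry gives 1 - T ≤ nδ, and the
support bound gives 1/T ≤ r^{n-1}; δ need not be small. -/
lemma neg_log_sum_rpow_le (hp : ∀ i, 0 ≤ p i) (hsum : ∑ i, p i = 1)
    (hr : ((Finset.univ.filter fun i => p i ≠ 0).card : ℝ) ≤ r) (hδ : 0 ≤ δ)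
    (hmax : ∃ i, 1 - δ ≤ p i) (hn : 1 < n) :
    -(1 / (n - 1)) * Real.log (∑ i, p i ^ n) ≤ n / (n - 1) * r ^ (n - 1) * δ := by
  obtain ⟨hT, hrT⟩ := rpow_neg_le_sum_rpow hp hsum hr hn
  set T := ∑ i, p i ^ n
  obtain ⟨i, hi⟩ := hmax
  have h1 : 1 - n * δ ≤ T := by
    have hb := one_add_mul_self_le_rpow_one_add (s := p i - 1) (by linarith [hp i]) hn.le
    rw [add_sub_cancel] at hb
    have : p i ^ n ≤ T :=
      Finset.single_le_sum (f := fun i => p i ^ n) (fun j _ => Real.rpow_nonneg (hp j) n)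
        (Finset.mem_univ i)
    nlinarith
  have h2 : -Real.log T ≤ n * δ * r ^ (n - 1) := by
    have h3 := Real.log_le_sub_one_of_pos (inv_pos.mpr hT)
    rw [Real.log_inv] at h3
    have h4 : T⁻¹ - 1 = (1 - T) * T⁻¹ := by field_simp
    have h5 : T⁻¹ ≤ r ^ (n - 1) := by
      rw [inv_le_iff_one_le_mul₀ hT]
      exact hrT
    calc -Real.log T ≤ (1 - T) * T⁻¹ := h4 ▸ h3
      _ ≤ n * δ * T⁻¹ := by
          have := inv_pos.mpr hT
          gcongr
          linarith
      _ ≤ n * δ * r ^ (n - 1) := by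
          gcongr
  have h6 : 0 < 1 / (n - 1) := by
    have : 0 < n - 1 := by linarith
    positivity
  calc -(1 / (n - 1)) * Real.log T = 1 / (n - 1) * -Real.log T := by ring
    _ ≤ 1 / (n - 1) * (n * δ * r ^ (n - 1)) := by gcongr
    _ = _ := by ring

lemma negMulLog_le_of_pos {x w : ℝ} (hx : 0 ≤ x) (hw : 0 < w) :
    Real.negMulLog x ≤ -x * Real.log w + w - x := by
  rcases hx.eq_or_lt with rfl | hx
  · simpa using hw.le
  have h := Real.log_le_sub_one_of_pos (div_pos hw hx)
  rw [Real.log_div hw.ne' hx.ne'] at h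
  have h2 := mul_le_mul_of_nonneg_left h hx.le
  have h3 : x * (w / x - 1) = w - x := by field_simp
  rw [h3] at h2
  rw [Real.negMulLog]
  linarith

/-- Gibbs' inequality against weights 1/2 at the large entry and 1/(2r) on the rest of the support,
of total mass at most 1. The cost is ln 2 everywhere, plus ln r away from the large entry. -/
lemma sum_negMulLog_le (hp : ∀ i, 0 ≤ p i) (hsum : ∑ i, p i = 1)
    (hr : ((Finset.univ.filter fun i => p i ≠ 0).card : ℝ) ≤ r) (hr1 : 1 ≤ r)
    (hmax : ∃ i, 1 - δ ≤ p i) :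
    ∑ i, Real.negMulLog (p i) ≤ δ * Real.log r + Real.log 2 := by
  classical
  obtain ⟨j, hj⟩ := hmax
  have hr0 : 0 < r := by linarith
  have hb (i : κ) : Real.negMulLog (p i) ≤ p i * Real.log 2 + (p i * Real.log r - p i) +
      ((if p i ≠ 0 then 1 / (2 * r) else 0) +
        (if i = j then 1 / 2 - p i * Real.log r else 0)) := by
    by_cases hij : i = j
    · have := negMulLog_le_of_pos (hp i) (w := 1 / 2) (by norm_num)
      rw [one_div, Real.log_inv] at this
      have h0 : (0 : ℝ) ≤ if p i ≠ 0 then 1 / (2 * r) else 0 := by split_ifs <;> positivity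
      rw [if_pos hij]
      linarith
    · rw [if_neg hij]
      by_cases h0 : p i = 0
      · simp [h0]
      · have := negMulLog_le_of_pos (hp i) (w := 1 / (2 * r)) (by positivity)
        rw [if_pos h0]
        rw [one_div, Real.log_inv, Real.log_mul two_ne_zero hr0.ne', ← one_div] at this
        linarith
  have h1 := Finset.sum_le_sum fun i (_ : i ∈ Finset.univ) => hb i
  rw [Finset.sum_add_distrib, Finset.sum_add_distrib, Finset.sum_add_distrib,
    Finset.sum_sub_distrib, ← Finset.sum_mul, ← Finset.sum_mul, hsum, Finset.sum_ite_eq',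
    if_pos (Finset.mem_univ j), ← Finset.sum_filter, Finset.sum_const, nsmul_eq_mul] at h1
  have h2 : ((Finset.univ.filter fun i => p i ≠ 0).card : ℝ) * (1 / (2 * r)) ≤ 1 / 2 := by
    rw [mul_one_div, div_le_iff₀ (by positivity)]
    linarith
  have h3 : (1 - p j) * Real.log r ≤ δ * Real.log r := by
    have := Real.log_nonneg hr1
    gcongr
    linarith
  linarith

/-- The normalized overlap of `p ^ (m / 2)` with the uniform vector differs from one by at most the
variance of `p` relative to the uniform distribution. -/
lemma one_sub_mul_sum_rpow_le_sq (hp : ∀ i, 0 ≤ p i) (hsum : ∑ i, p i = 1) {m : ℝ} (hm₁ : 1 ≤ m)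
    (hm₂ : m ≤ 2) :
    (1 - (Fintype.card κ * ∑ i, p i ^ 2 - 1)) * (Fintype.card κ * ∑ i, p i ^ m) ≤
      (∑ i, p i ^ (m / 2)) ^ 2 := by
  set d : ℝ := (Fintype.card κ : ℝ) with hd
  have hd0 : 0 < d := by
    have : Nonempty κ := by
      by_contra h
      rw [not_nonempty_iff] at h
      simp at hsum
    rw [hd]
    exact_mod_cast Fintype.card_pos
  set δ := d * ∑ i, p i ^ 2 - 1 with hδ
  set A := ∑ i, (d * p i) ^ (m / 2) with hA
  set B := ∑ i, (d * p i) ^ m with hB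
  have hy (i : κ) : 0 ≤ d * p i := mul_nonneg hd0.le (hp i)
  have hA' : A = d ^ (m / 2) * ∑ i, p i ^ (m / 2) := by
    rw [hA, Finset.mul_sum]
    exact Finset.sum_congr rfl fun i _ => Real.mul_rpow hd0.le (hp i)
  have hB' : B = d ^ m * ∑ i, p i ^ m := by
    rw [hB, Finset.mul_sum]
    exact Finset.sum_congr rfl fun i _ => Real.mul_rpow hd0.le (hp i)
  have hsq {x : ℝ} (hx : 0 ≤ x) : (x ^ (m / 2)) ^ 2 = x ^ m := by
    rw [← Real.rpow_natCast, ← Real.rpow_mul hx]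
    norm_num
  -- Bernoulli's inequality, summed: the linear terms cancel because the numbers d p_i have mean 1.
  -- This uses m ≥ 1.
  have hBd : d ≤ B := by
    have : ∑ i, (1 + m * (d * p i - 1)) ≤ B := Finset.sum_le_sum fun i _ => by
      have := one_add_mul_self_le_rpow_one_add (s := d * p i - 1) (by linarith [hy i]) hm₁
      rwa [add_sub_cancel] at this
    rw [Finset.sum_add_distrib, ← Finset.mul_sum, Finset.sum_sub_distrib, ← Finset.mul_sum,
      hsum] at this
    simpa [← hd] using this
  -- Since 0 < m/2 ≤ 1, the power lies between 1 and x.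
  have habs {x : ℝ} (hx : 0 ≤ x) : (x ^ (m / 2) - 1) ^ 2 ≤ (x - 1) ^ 2 := by
    rcases le_total 1 x with h | h
    · have h1 : x ^ (m / 2) ≤ x ^ (1 : ℝ) := Real.rpow_le_rpow_of_exponent_le h (by linarith)
      have h2 : 1 ≤ x ^ (m / 2) := Real.one_le_rpow h (by linarith)
      rw [Real.rpow_one] at h1
      nlinarith
    · have h2 : x ^ (m / 2) ≤ 1 := Real.rpow_le_one hx h (by linarith)
      have h1 : x ≤ x ^ (m / 2) := by
        rcases hx.eq_or_lt with rfl | hx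
        · exact Real.rpow_nonneg le_rfl _
        · conv_lhs => rw [← Real.rpow_one x]
          exact Real.rpow_le_rpow_of_exponent_ge hx h (by linarith)
      nlinarith
  have hvar : ∑ i, (d * p i - 1) ^ 2 = d * δ := by
    have : ∑ i, (d * p i - 1) ^ 2 = ∑ i, (d ^ 2 * p i ^ 2 - 2 * d * p i + 1) :=
      Finset.sum_congr rfl fun i _ => by ring
    rw [this, Finset.sum_add_distrib, Finset.sum_sub_distrib, ← Finset.mul_sum,
      ← Finset.mul_sum, hsum, hδ]
    simp [← hd]
    ring
  have hdev : B - 2 * A + d ≤ d * δ := by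
    have h1 : ∑ i, ((d * p i) ^ (m / 2) - 1) ^ 2 ≤ ∑ i, (d * p i - 1) ^ 2 :=
      Finset.sum_le_sum fun i _ => habs (hy i)
    have h2 : ∑ i, ((d * p i) ^ (m / 2) - 1) ^ 2 = B - 2 * A + d := by
      rw [hA, hB, Finset.mul_sum, ← Finset.sum_sub_distrib]
      have : d = ∑ i : κ, (1 : ℝ) := by simp [hd]
      conv_rhs => rw [this, ← Finset.sum_add_distrib, ← this]
      refine Finset.sum_congr rfl fun i _ => ?_
      rw [← hsq (hy i)]
      ring
    linarith
  have hδ0 : 0 ≤ δ := by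
    have := sq_sum_le_card_mul_sum_sq (s := Finset.univ) (f := p)
    rw [hsum, one_pow, Finset.card_univ, ← hd] at this
    linarith
  -- From d ≤ B, the deviation bound becomes (1 - δ)B + d ≤ 2A; AM-GM on the left side then finishes
  -- when 1 - δ > 0.
  have hmain : (1 - δ) * (d * B) ≤ A ^ 2 := by
    rcases le_or_gt (1 - δ) 0 with h | h
    · exact (mul_nonpos_of_nonpos_of_nonneg h (mul_nonneg hd0.le (hd0.le.trans hBd))).trans (sq_nonneg A)
    · have h1 : (1 - δ) * B + d ≤ 2 * A := by nlinarith
      have h2 : 0 ≤ (1 - δ) * B + d := by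
        have := mul_nonneg h.le (hd0.le.trans hBd)
        linarith
      nlinarith [sq_nonneg ((1 - δ) * B - d)]
  have hdm : 0 < d ^ m := Real.rpow_pos_of_pos hd0 m
  refine le_of_mul_le_mul_left ?_ hdm
  calc d ^ m * ((1 - δ) * (d * ∑ i, p i ^ m)) = (1 - δ) * (d * B) := by rw [hB']; ring
    _ ≤ A ^ 2 := hmain
    _ = d ^ m * (∑ i, p i ^ (m / 2)) ^ 2 := by rw [hA', mul_pow, hsq hd0.le]

end ProbabilityVector

/-! ### The reflected density matrix -/

/-- The excess `d * Tr ρ ^ 2 - 1` of the purity over that of the maximally mixed state. -/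
noncomputable def purityExcess {ι : Type*} [Fintype ι] (ρ : Matrix ι ι ℂ) : ℝ :=
  Fintype.card ι * (ρ * ρ).trace.re - 1

section PurityExcess

variable {ι : Type*} [Fintype ι] [DecidableEq ι] {ρ : Matrix ι ι ℂ}

lemma trace_matPow_eq_sum (hρ : ρ.PosSemidef) (s : ℝ) :
    (matPow ρ s).trace = ((∑ i, hρ.isHermitian.eigenvalues i ^ s : ℝ) : ℂ) :=
  hρ.isHermitian.trace_cfc _

lemma purityExcess_eq (hρ : ρ.PosSemidef) :
    purityExcess ρ = Fintype.card ι * ∑ i, hρ.isHermitian.eigenvalues i ^ 2 - 1 := by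
  have h : ρ * ρ = cfc (fun x : ℝ => x ^ 2) ρ := by
    conv_lhs => rw [← cfc_id ℝ ρ hρ.isHermitian]
    exact hρ.cfc_mul_cfc_eq fun x _ => (sq x).symm
  rw [purityExcess, h, hρ.isHermitian.trace_cfc, Complex.ofReal_re]

lemma purityExcess_nonneg (hρ : ρ.PosSemidef) (htr : ρ.trace = 1) : 0 ≤ purityExcess ρ := by
  have := sq_sum_le_card_mul_sum_sq (s := Finset.univ) (f := hρ.isHermitian.eigenvalues)
  rw [hρ.sum_eigenvalues_eq_one htr, one_pow, Finset.card_univ] at this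
  rw [purityExcess_eq hρ]
  linarith

lemma trace_matPow_pos (hρ : ρ.PosSemidef) (htr : ρ.trace = 1) (s : ℝ) :
    0 < (matPow ρ s).trace.re := by
  rw [trace_matPow_eq_sum hρ, Complex.ofReal_re]
  obtain ⟨i, -, hi⟩ : ∃ i ∈ Finset.univ, hρ.isHermitian.eigenvalues i ≠ 0 := by
    apply Finset.exists_ne_zero_of_sum_ne_zero
    rw [hρ.sum_eigenvalues_eq_one htr]
    exact one_ne_zero
  refine Finset.sum_pos' (fun j _ => Real.rpow_nonneg (hρ.eigenvalues_nonneg j) s)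
    ⟨i, Finset.mem_univ i, Real.rpow_pos_of_pos ?_ s⟩
  exact lt_of_le_of_ne (hρ.eigenvalues_nonneg i) hi.symm

lemma isHermitian_matPow (s : ℝ) : (matPow ρ s).IsHermitian :=
  cfc_predicate (p := IsSelfAdjoint) _ ρ

lemma matPow_half_mul_matPow_half (hρ : ρ.PosSemidef) {m : ℝ} (hm : 0 < m) :
    matPow ρ (m / 2) * matPow ρ (m / 2) = matPow ρ m :=
  hρ.cfc_mul_cfc_eq fun x hx => by
    rw [← Real.rpow_add_of_nonneg hx (by linarith) (by linarith), add_halves]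

end PurityExcess

/-! ### Overlaps and maximally entangled vectors -/

section DotProduct

variable {κ μ : Type*} [Fintype κ] [Fintype μ]

lemma norm_dotProduct_sq_le (u w : κ → ℂ) :
    ‖u ⬝ᵥ w‖ ^ 2 ≤ (∑ i, ‖u i‖ ^ 2) * ∑ i, ‖w i‖ ^ 2 := by
  refine le_trans ?_ (Finset.sum_mul_sq_le_sq_mul_sq _ _ _)
  gcongr
  rw [dotProduct]
  exact (norm_sum_le _ _).trans_eq (Finset.sum_congr rfl fun i _ => norm_mul _ _)

lemma re_dotProduct_mul_conjTranspose_mulVec (R : Matrix κ μ ℂ) (v : κ → ℂ) :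
    (star v ⬝ᵥ ((R * Rᴴ) *ᵥ v)).re = ∑ b, ‖(star v ᵥ* R) b‖ ^ 2 := by
  rw [← mulVec_mulVec, dotProduct_mulVec]
  have h : Rᴴ *ᵥ v = star (star v ᵥ* R) := by
    rw [star_vecMul, star_star]
  rw [h, dotProduct, Complex.re_sum]
  refine Finset.sum_congr rfl fun b _ => ?_
  rw [Pi.star_apply, RCLike.star_def, Complex.mul_conj', ← Complex.ofReal_pow, Complex.ofReal_re]

/-- The maximally entangled unit vector of `ℂ^κ ⊗ ℂ^κ`. -/
noncomputable def maxEntangled (κ : Type*) [Fintype κ] [DecidableEq κ] : κ × κ → ℂ :=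
  fun a => if a.1 = a.2 then (((√(Fintype.card κ))⁻¹ : ℝ) : ℂ) else 0

variable [DecidableEq κ]

lemma star_maxEntangled : star (maxEntangled κ) = maxEntangled κ := by
  ext a
  rw [Pi.star_apply, maxEntangled]
  split_ifs <;> simp

lemma sum_norm_maxEntangled_sq [Nonempty κ] : ∑ a, ‖maxEntangled κ a‖ ^ 2 = 1 := by
  have h : (0 : ℝ) < Fintype.card κ := by exact_mod_cast Fintype.card_pos
  rw [Fintype.sum_prod_type]
  simp [maxEntangled, apply_ite, ite_pow, h.ne']

lemma dotProduct_maxEntangled [Nonempty κ] :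
    star (maxEntangled κ) ⬝ᵥ maxEntangled κ = 1 := by
  rw [dotProduct, ← Complex.ofReal_one, ← sum_norm_maxEntangled_sq (κ := κ), Complex.ofReal_sum]
  refine Finset.sum_congr rfl fun a _ => ?_
  rw [Pi.star_apply, RCLike.star_def, Complex.conj_mul', Complex.ofReal_pow]

end DotProduct

section Reflected

variable {α β : Type*} [Fintype α] [DecidableEq α] [Fintype β] [DecidableEq β]
  {ρ : Matrix (α × β) (α × β) ℂ} {m n : ℝ}

/-- The coefficients of `reflectedKet m ρ` as a matrix from `BB*` to `AA*`. -/
noncomputable def reflectedMatrix (m : ℝ) (ρ : Matrix (α × β) (α × β) ℂ) :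
    Matrix (α × α) (β × β) ℂ :=
  Matrix.of fun a b => reflectedKet m ρ (a, b)

lemma reflectedMatrix_apply (a : α × α) (b : β × β) :
    reflectedMatrix m ρ a b =
      (((matPow ρ m).trace.re ^ (-(1 / 2) : ℝ) : ℝ) : ℂ) *
        matPow ρ (m / 2) (a.1, b.1) (a.2, b.2) := rfl

lemma reflectedDensity_eq : reflectedDensity m ρ = reflectedMatrix m ρ * (reflectedMatrix m ρ)ᴴ := by
  ext a a'
  simp [reflectedDensity, partialTraceSnd, ketBra, vecMulVec_apply, mul_apply, reflectedMatrix]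

lemma posSemidef_reflectedDensity : (reflectedDensity m ρ).PosSemidef := by
  rw [reflectedDensity_eq]
  exact posSemidef_self_mul_conjTranspose _

/-- The coefficient matrix has χ_A² rows and χ_B² columns, and R Rᴴ has the rank of R. -/
lemma rank_reflectedDensity_le :
    (reflectedDensity m ρ).rank ≤ Fintype.card α ^ 2 ∧
      (reflectedDensity m ρ).rank ≤ Fintype.card β ^ 2 := by
  refine ⟨(rank_le_card_width _).trans_eq (by rw [Fintype.card_prod, sq]), ?_⟩
  rw [reflectedDensity_eq, rank_self_mul_conjTranspose]
  exact (rank_le_card_width _).trans_eq (by rw [Fintype.card_prod, sq])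

lemma rpow_neg_half_sq {T : ℝ} (hT : 0 < T) : (T ^ (-(1 / 2) : ℝ)) ^ 2 = T⁻¹ := by
  rw [← Real.rpow_natCast, ← Real.rpow_mul hT.le, ← Real.rpow_neg_one]
  norm_num

omit [DecidableEq α] [DecidableEq β] in
-- Regrouping the indices permutes the entries and so preserves the Hilbert–Schmidt norm.
lemma trace_reshape_mul_conjTranspose {c : ℝ} {X : Matrix (α × β) (α × β) ℂ}
    {R : Matrix (α × α) (β × β) ℂ} (h : ∀ a b, R a b = c * X (a.1, b.1) (a.2, b.2)) :
    (R * Rᴴ).trace = (c : ℂ) ^ 2 * (X * Xᴴ).trace := by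
  simp only [trace, diag, mul_apply, Fintype.sum_prod_type, conjTranspose_apply, h,
    Finset.mul_sum]
  refine Finset.sum_congr rfl fun a _ => ?_
  rw [Finset.sum_comm]
  refine Finset.sum_congr rfl fun b _ => Finset.sum_congr rfl fun a' _ =>
    Finset.sum_congr rfl fun b' _ => ?_
  rw [star_mul', RCLike.star_def, Complex.conj_ofReal]
  ring

lemma trace_reflectedDensity (hρ : ρ.PosSemidef) (htr : ρ.trace = 1) (hm : 0 < m) :
    (reflectedDensity m ρ).trace = 1 := by
  have hT := trace_matPow_pos hρ htr m
  have hTc : ((matPow ρ m).trace.re : ℂ) = (matPow ρ m).trace := by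
    rw [trace_matPow_eq_sum hρ, Complex.ofReal_re]
  rw [reflectedDensity_eq, trace_reshape_mul_conjTranspose reflectedMatrix_apply,
    (isHermitian_matPow (ρ := ρ) (m / 2)).eq, matPow_half_mul_matPow_half hρ hm,
    ← Complex.ofReal_pow, rpow_neg_half_sq hT, ← hTc, ← Complex.ofReal_mul, Complex.ofReal_re,
    inv_mul_cancel₀ hT.ne', Complex.ofReal_one]

/-- The product of the two maximally entangled vectors is the identity operator over √d, viewed as a
vector; its overlap with |X⟩ is Tr X/√d. -/
lemma dotProduct_reflectedMatrix_mulVec :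
    (star (maxEntangled α) ᵥ* reflectedMatrix m ρ) ⬝ᵥ maxEntangled β =
      (((matPow ρ m).trace.re ^ (-(1 / 2) : ℝ) * (√(Fintype.card α))⁻¹ *
        (√(Fintype.card β))⁻¹ : ℝ) : ℂ) * (matPow ρ (m / 2)).trace := by
  rw [star_maxEntangled]
  simp only [dotProduct, vecMul, Fintype.sum_prod_type, reflectedMatrix_apply, maxEntangled,
    trace, diag, ite_mul, zero_mul, mul_ite, mul_zero, Finset.sum_ite_eq, Finset.mem_univ, if_true,
    Finset.mul_sum, Finset.sum_mul]
  rw [Finset.sum_comm]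
  refine Finset.sum_congr rfl fun a _ => Finset.sum_congr rfl fun b _ => ?_
  push_cast
  ring

/-- Testing R Rᴴ on the maximally entangled vector of AA* gives the squared norm of a vector on BB*;
Cauchy–Schwarz against the maximally entangled vector there reduces the claim to the eigenvalues of
ρ. -/
lemma exists_one_sub_le_eigenvalues_reflectedDensity (hρ : ρ.PosSemidef) (htr : ρ.trace = 1)
    (hm₁ : 1 ≤ m) (hm₂ : m ≤ 2) :
    ∃ i, 1 - purityExcess ρ ≤
      (posSemidef_reflectedDensity (m := m) (ρ := ρ)).isHermitian.eigenvalues i := by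
  have hne : Nonempty (α × β) := by
    by_contra h
    rw [not_nonempty_iff] at h
    simp [trace] at htr
  have hα : Nonempty α := hne.map Prod.fst
  have hβ : Nonempty β := hne.map Prod.snd
  obtain ⟨i, hi⟩ := (posSemidef_reflectedDensity
    (m := m) (ρ := ρ)).isHermitian.exists_re_dotProduct_le_eigenvalues
      (dotProduct_maxEntangled (κ := α))
  refine ⟨i, le_trans ?_ hi⟩
  rw [reflectedDensity_eq, re_dotProduct_mul_conjTranspose_mulVec]
  have h1 := norm_dotProduct_sq_le (star (maxEntangled α) ᵥ* reflectedMatrix m ρ) (maxEntangled β)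
  rw [sum_norm_maxEntangled_sq, mul_one, dotProduct_reflectedMatrix_mulVec, norm_mul, mul_pow,
    Complex.norm_real, Real.norm_eq_abs, sq_abs, mul_pow, mul_pow,
    rpow_neg_half_sq (trace_matPow_pos hρ htr m), inv_pow, inv_pow, Real.sq_sqrt (by positivity),
    Real.sq_sqrt (by positivity), trace_matPow_eq_sum hρ (m / 2), Complex.norm_real, Real.norm_eq_abs,
    sq_abs] at h1
  refine le_trans ?_ h1
  have h2 := one_sub_mul_sum_rpow_le_sq hρ.eigenvalues_nonneg (hρ.sum_eigenvalues_eq_one htr)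
    hm₁ hm₂
  rw [← purityExcess_eq hρ] at h2
  have hT := trace_matPow_pos hρ htr m
  have hT' : (matPow ρ m).trace.re = ∑ i, hρ.isHermitian.eigenvalues i ^ m := by
    rw [trace_matPow_eq_sum hρ, Complex.ofReal_re]
  rw [← hT', Fintype.card_prod, Nat.cast_mul] at h2
  have hα0 : (0 : ℝ) < Fintype.card α := by exact_mod_cast Fintype.card_pos
  have hβ0 : (0 : ℝ) < Fintype.card β := by exact_mod_cast Fintype.card_pos
  rw [← mul_inv, ← mul_inv, inv_mul_eq_div, le_div_iff₀ (by positivity)]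
  refine le_trans (le_of_eq ?_) h2
  ring

lemma card_eigenvalues_ne_zero {ι : Type*} [Fintype ι] [DecidableEq ι] {A : Matrix ι ι ℂ}
    (hA : A.IsHermitian) :
    (Finset.univ.filter fun i => hA.eigenvalues i ≠ 0).card = A.rank := by
  rw [hA.rank_eq_card_non_zero_eigs, Fintype.card_subtype]

lemma renyiReflectedEntropy_le (hρ : ρ.PosSemidef) (htr : ρ.trace = 1) (hm₁ : 1 ≤ m) (hm₂ : m ≤ 2)
    (hn : 1 < n) {k : ℕ} (hk : (reflectedDensity m ρ).rank ≤ k ^ 2) :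
    renyiReflectedEntropy m n ρ ≤ n / (n - 1) * (k : ℝ) ^ (2 * (n - 1)) * purityExcess ρ := by
  have hσ := posSemidef_reflectedDensity (m := m) (ρ := ρ)
  rw [renyiReflectedEntropy, renyiEntropy, if_neg hn.ne', trace_matPow_eq_sum hσ, Complex.ofReal_re,
    Real.rpow_mul (by positivity)]
  refine neg_log_sum_rpow_le hσ.eigenvalues_nonneg
    (hσ.sum_eigenvalues_eq_one (trace_reflectedDensity hρ htr (by linarith))) ?_
    (purityExcess_nonneg hρ htr)
    (exists_one_sub_le_eigenvalues_reflectedDensity hρ htr hm₁ hm₂) hn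
  rw [card_eigenvalues_ne_zero, Real.rpow_two]
  exact_mod_cast hk

lemma renyiReflectedEntropy_one_le (hρ : ρ.PosSemidef) (htr : ρ.trace = 1) (hm₁ : 1 ≤ m)
    (hm₂ : m ≤ 2) {k : ℕ} (hk0 : 1 ≤ k) (hk : (reflectedDensity m ρ).rank ≤ k ^ 2) :
    renyiReflectedEntropy m 1 ρ ≤ 2 * Real.log k * purityExcess ρ + Real.log 2 := by
  have hσ := posSemidef_reflectedDensity (m := m) (ρ := ρ)
  rw [renyiReflectedEntropy, renyiEntropy, if_pos rfl, vonNeumannEntropy,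
    hσ.isHermitian.trace_cfc, Complex.ofReal_re]
  refine (sum_negMulLog_le (r := (k : ℝ) ^ 2) hσ.eigenvalues_nonneg
    (hσ.sum_eigenvalues_eq_one (trace_reflectedDensity hρ htr (by linarith))) ?_ ?_
    (exists_one_sub_le_eigenvalues_reflectedDensity hρ htr hm₁ hm₂)).trans_eq ?_
  · rw [card_eigenvalues_ne_zero]
    exact_mod_cast hk
  · exact one_le_pow₀ (by exact_mod_cast hk0)
  · rw [Real.log_pow]
    push_cast
    ring

/-- Supplies integrability over the compact unitary group. Strict positivity of the traces keeps the
normalization and the logarithm away from their singularity at 0. -/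
lemma continuous_renyiReflectedEntropy {X : Type*} [TopologicalSpace X]
    {a : X → Matrix (α × β) (α × β) ℂ} (ha : Continuous a) (hpos : ∀ x, (a x).PosSemidef)
    (htr : ∀ x, (a x).trace = 1) (hm : 0 < m) (hn : 1 ≤ n) :
    Continuous fun x => renyiReflectedEntropy m n (a x) := by
  have hpow {s : ℝ} (hs : 0 < s) : Continuous fun x => matPow (a x) s :=
    continuous_cfc_of_density (Real.continuous_rpow_const hs.le) ha hpos htr
  have hσ : Continuous fun x => reflectedDensity m (a x) := by
    have hR : Continuous fun x => reflectedMatrix m (a x) := by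
      refine continuous_matrix fun i j => ?_
      simp only [reflectedMatrix_apply]
      refine Continuous.mul (Complex.continuous_ofReal.comp ?_)
        ((hpow (half_pos hm)).matrix_elem _ _)
      exact (Complex.continuous_re.comp (hpow hm).matrix_trace).rpow_const
        fun x => Or.inl (trace_matPow_pos (hpos x) (htr x) m).ne'
    simp only [reflectedDensity_eq]
    exact hR.matrix_mul hR.matrix_conjTranspose
  have hσpos (x : X) := posSemidef_reflectedDensity (m := m) (ρ := a x)
  have hσtr (x : X) := trace_reflectedDensity (hpos x) (htr x) hm
  rcases hn.eq_or_lt with rfl | hn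
  · simp only [renyiReflectedEntropy, renyiEntropy, if_true, vonNeumannEntropy]
    exact Complex.continuous_re.comp
      (continuous_cfc_of_density Real.continuous_negMulLog hσ hσpos hσtr).matrix_trace
  · simp only [renyiReflectedEntropy, renyiEntropy, if_neg hn.ne']
    refine continuous_const.mul (Continuous.log (Complex.continuous_re.comp
      (Continuous.matrix_trace ?_)) fun x => (trace_matPow_pos (hσpos x) (hσtr x) n).ne')
    exact continuous_cfc_of_density (Real.continuous_rpow_const (by linarith)) hσ hσpos hσtr

end Reflected

/-! ### Fourth moments of a Haar-random state -/

section HaarMoments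

variable {ι : Type*} [Fintype ι] [DecidableEq ι]

instance isProbabilityMeasure_haarUnitary : IsProbabilityMeasure (haarUnitary ι) :=
  ⟨Measure.haarMeasure_self⟩

instance isMulLeftInvariant_haarUnitary : (haarUnitary ι).IsMulLeftInvariant :=
  inferInstanceAs (Measure.haarMeasure ⊤).IsMulLeftInvariant

lemma integrable_haarUnitary {f : unitaryGroup ι ℂ → ℝ} (hf : Continuous f) :
    Integrable f (haarUnitary ι) :=
  hf.integrable_of_hasCompactSupport (HasCompactSupport.of_compactSpace f)

lemma continuous_unitary_mulVec (φ : ι → ℂ) :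
    Continuous fun U : unitaryGroup ι ℂ => (U : Matrix ι ι ℂ) *ᵥ φ :=
  continuous_subtype_val.matrix_mulVec continuous_const

lemma continuous_unitary_mulVec_apply (φ : ι → ℂ) (i : ι) :
    Continuous fun U : unitaryGroup ι ℂ => ((U : Matrix ι ι ℂ) *ᵥ φ) i :=
  (continuous_apply i).comp (continuous_unitary_mulVec φ)

/-- Haar averages of functions of `U φ` are invariant under unitaries. -/
lemma integral_unitary_mulVec (φ : ι → ℂ) (g : (ι → ℂ) → ℝ) (V : unitaryGroup ι ℂ) :
    ∫ U, g ((V : Matrix ι ι ℂ) *ᵥ ((U : Matrix ι ι ℂ) *ᵥ φ)) ∂haarUnitary ι =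
      ∫ U, g ((U : Matrix ι ι ℂ) *ᵥ φ) ∂haarUnitary ι := by
  simpa only [mulVec_mulVec, Submonoid.coe_mul] using integral_mul_left_eq_self
    (μ := haarUnitary ι) (fun U : unitaryGroup ι ℂ => g ((U : Matrix ι ι ℂ) *ᵥ φ)) V

lemma sum_norm_unitary_mulVec_sq (φ : ι → ℂ) (U : unitaryGroup ι ℂ) :
    ∑ i, ‖((U : Matrix ι ι ℂ) *ᵥ φ) i‖ ^ 2 = ∑ i, ‖φ i‖ ^ 2 := by
  have h (v : ι → ℂ) : ((∑ i, ‖v i‖ ^ 2 : ℝ) : ℂ) = star v ⬝ᵥ v := by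
    rw [dotProduct, Complex.ofReal_sum]
    refine Finset.sum_congr rfl fun i _ => ?_
    rw [Pi.star_apply, RCLike.star_def, Complex.conj_mul', Complex.ofReal_pow]
  apply Complex.ofReal_injective
  rw [h, h, star_mulVec, dotProduct_mulVec, vecMul_vecMul, ← star_eq_conjTranspose,
    UnitaryGroup.star_mul_self, vecMul_one]

/-- The diagonal unitary multiplying the coordinate `j` by the phase `ω`. -/
noncomputable def phaseUnitary (j : ι) (ω : ℂ) (hω : star ω * ω = 1) : unitaryGroup ι ℂ :=
  ⟨diagonal fun k => if k = j then ω else 1, by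
    rw [mem_unitaryGroup_iff', star_eq_conjTranspose, diagonal_conjTranspose,
      diagonal_mul_diagonal, ← diagonal_one]
    congr 1
    ext k
    by_cases hk : k = j
    · simpa [hk] using hω
    · simp [hk]⟩

lemma phaseUnitary_mulVec (j : ι) (ω : ℂ) (hω : star ω * ω = 1) (x : ι → ℂ) (k : ι) :
    ((phaseUnitary j ω hω : Matrix ι ι ℂ) *ᵥ x) k = (if k = j then ω else 1) * x k :=
  mulVec_diagonal _ _ _

/-- The reflection along `e_i + 2 e_j`. -/
noncomputable def reflectionUnitary {i j : ι} (hij : i ≠ j) : unitaryGroup ι ℂ :=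
  ⟨1 - (2 / 5 : ℂ) • vecMulVec (Pi.single i 1 + Pi.single j 2) (Pi.single i 1 + Pi.single j 2), by
    set v : ι → ℂ := Pi.single i 1 + Pi.single j 2 with hv
    have hvv : v ⬝ᵥ v = 5 := by
      simp only [hv, dotProduct_add, dotProduct_single, Pi.add_apply, Pi.single_eq_same,
        Pi.single_eq_of_ne hij, Pi.single_eq_of_ne hij.symm]
      norm_num
    have hsv : star v = v := by
      rw [hv, star_add, ← Pi.single_star, ← Pi.single_star]
      simp
    have hstar : star (1 - (2 / 5 : ℂ) • vecMulVec v v) = 1 - (2 / 5 : ℂ) • vecMulVec v v := by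
      rw [star_eq_conjTranspose, conjTranspose_sub, conjTranspose_smul, conjTranspose_vecMulVec,
        hsv, conjTranspose_one]
      congr 2
      simp
    have hsq : vecMulVec v v * vecMulVec v v = (5 : ℂ) • vecMulVec v v := by
      rw [vecMulVec_mul_vecMulVec, hvv, vecMulVec_smul]
    rw [mem_unitaryGroup_iff', hstar, sub_mul, mul_sub, mul_sub, one_mul, one_mul, mul_one,
      smul_mul_assoc, mul_smul_comm, hsq]
    module⟩

lemma reflectionUnitary_mulVec {i j : ι} (hij : i ≠ j) (x : ι → ℂ) (k : ι) :
    ((reflectionUnitary hij : Matrix ι ι ℂ) *ᵥ x) k =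
      x k - 2 / 5 * ((Pi.single i 1 + Pi.single j 2 : ι → ℂ) k * (x i + 2 * x j)) := by
  rw [reflectionUnitary]
  simp only [sub_mulVec, one_mulVec, smul_mulVec, vecMulVec_mulVec, Pi.sub_apply, Pi.smul_apply,
    add_dotProduct, single_dotProduct, smul_eq_mul, one_mul, MulOpposite.smul_eq_mul_unop,
    MulOpposite.unop_op]

/-- The moment `E |ψ i|² |ψ j|²` of the random vector `ψ = U φ`. -/
noncomputable def haarMoment (φ : ι → ℂ) (i j : ι) : ℝ :=
  ∫ U : unitaryGroup ι ℂ, ‖((U : Matrix ι ι ℂ) *ᵥ φ) i‖ ^ 2 * ‖((U : Matrix ι ι ℂ) *ᵥ φ) j‖ ^ 2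
    ∂haarUnitary ι

lemma integrable_haarMoment (φ : ι → ℂ) (i j : ι) :
    Integrable (fun U : unitaryGroup ι ℂ =>
      ‖((U : Matrix ι ι ℂ) *ᵥ φ) i‖ ^ 2 * ‖((U : Matrix ι ι ℂ) *ᵥ φ) j‖ ^ 2) (haarUnitary ι) :=
  integrable_haarUnitary (((continuous_unitary_mulVec_apply φ i).norm.pow 2).mul
    ((continuous_unitary_mulVec_apply φ j).norm.pow 2))

/-- Averaging over the fourth roots of unity removes every cross term that depends on the relative
phase of a and b. -/
lemma sum_norm_add_phase_mul_pow_four (s t : ℝ) (a b : ℂ) :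
    ‖s * a + t * b‖ ^ 4 + ‖s * a + t * (-1 * b)‖ ^ 4 + ‖s * a + t * (Complex.I * b)‖ ^ 4 +
      ‖s * a + t * (-Complex.I * b)‖ ^ 4 =
    4 * (s ^ 4 * (‖a‖ ^ 2 * ‖a‖ ^ 2) + t ^ 4 * (‖b‖ ^ 2 * ‖b‖ ^ 2) +
      4 * (s ^ 2 * t ^ 2) * (‖a‖ ^ 2 * ‖b‖ ^ 2)) := by
  have h (z : ℂ) : ‖z‖ ^ 4 = (‖z‖ ^ 2) ^ 2 := by ring
  simp only [h, ← Complex.normSq_eq_norm_sq, Complex.normSq_apply]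
  simp
  ring

/-- Invariance under V replaces ψ_k by sψ_i + tψ_j; invariance under phases on coordinate j then
permits the four-phase average. -/
lemma haarMoment_self_eq (φ : ι → ℂ) {i j k : ι} (hij : i ≠ j) {s t : ℝ} (V : unitaryGroup ι ℂ)
    (hV : ∀ x : ι → ℂ, ((V : Matrix ι ι ℂ) *ᵥ x) k = s * x i + t * x j) :
    haarMoment φ k k =
      s ^ 4 * haarMoment φ i i + t ^ 4 * haarMoment φ j j + 4 * (s ^ 2 * t ^ 2) *
        haarMoment φ i j := by
  have h1 : haarMoment φ k k = ∫ U : unitaryGroup ι ℂ,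
      ‖s * ((U : Matrix ι ι ℂ) *ᵥ φ) i + t * ((U : Matrix ι ι ℂ) *ᵥ φ) j‖ ^ 4 ∂haarUnitary ι := by
    rw [haarMoment, ← integral_unitary_mulVec φ (fun x => ‖x k‖ ^ 2 * ‖x k‖ ^ 2) V]
    simp only [hV]
    exact integral_congr_ae (ae_of_all _ fun U => by ring)
  have h2 (ω : ℂ) (hω : star ω * ω = 1) : haarMoment φ k k = ∫ U : unitaryGroup ι ℂ,
      ‖s * ((U : Matrix ι ι ℂ) *ᵥ φ) i + t * (ω * ((U : Matrix ι ι ℂ) *ᵥ φ) j)‖ ^ 4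
        ∂haarUnitary ι := by
    rw [h1, ← integral_unitary_mulVec φ (fun x => ‖s * x i + t * x j‖ ^ 4) (phaseUnitary j ω hω)]
    simp only [phaseUnitary_mulVec, if_neg hij, if_true, one_mul]
  have hint (ω : ℂ) : Integrable (fun U : unitaryGroup ι ℂ =>
      ‖s * ((U : Matrix ι ι ℂ) *ᵥ φ) i + t * (ω * ((U : Matrix ι ι ℂ) *ᵥ φ) j)‖ ^ 4)
        (haarUnitary ι) := by
    have hi := continuous_unitary_mulVec_apply φ i
    have hj := continuous_unitary_mulVec_apply φ j
    exact integrable_haarUnitary (by fun_prop)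
  have hint1 := hint 1
  simp only [one_mul] at hint1
  have hadd {f₁ f₂ f₃ f₄ : unitaryGroup ι ℂ → ℝ} (i₁ : Integrable f₁ (haarUnitary ι))
      (i₂ : Integrable f₂ (haarUnitary ι)) (i₃ : Integrable f₃ (haarUnitary ι))
      (i₄ : Integrable f₄ (haarUnitary ι)) :
      ∫ U, (f₁ U + f₂ U + f₃ U + f₄ U) ∂haarUnitary ι =
        ∫ U, f₁ U ∂haarUnitary ι + ∫ U, f₂ U ∂haarUnitary ι + ∫ U, f₃ U ∂haarUnitary ι +
          ∫ U, f₄ U ∂haarUnitary ι := by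
    rw [← integral_add' i₁ i₂, ← integral_add' (i₁.add i₂) i₃,
      ← integral_add' ((i₁.add i₂).add i₃) i₄]
    rfl
  have h3 : 4 * haarMoment φ k k = 4 * (s ^ 4 * haarMoment φ i i + t ^ 4 * haarMoment φ j j +
      4 * (s ^ 2 * t ^ 2) * haarMoment φ i j) := by
    calc 4 * haarMoment φ k k = haarMoment φ k k + haarMoment φ k k + haarMoment φ k k +
          haarMoment φ k k := by ring
      _ = _ := by
        nth_rewrite 1 [h1]
        nth_rewrite 1 [h2 (-1) (by simp)]
        nth_rewrite 1 [h2 Complex.I (by simp)]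
        rw [h2 (-Complex.I) (by simp), ← hadd hint1 (hint _) (hint _) (hint _)]
        simp only [sum_norm_add_phase_mul_pow_four]
        rw [integral_const_mul, integral_add, integral_add, integral_const_mul, integral_const_mul,
          integral_const_mul]
        · rfl
        · exact (integrable_haarMoment φ i i).const_mul _
        · exact (integrable_haarMoment φ j j).const_mul _
        · exact ((integrable_haarMoment φ i i).const_mul _).add
            ((integrable_haarMoment φ j j).const_mul _)
        · exact (integrable_haarMoment φ i j).const_mul _
  linarith

/-- The reflection acts on the two coordinates with entries ±3/5, ±4/5, the 3-4-5 triangle keeping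
everything rational. Its two rows give two linear equations that determine the moments up to scale.
-/
lemma haarMoment_of_ne (φ : ι → ℂ) {i j : ι} (hij : i ≠ j) :
    haarMoment φ j j = haarMoment φ i i ∧ haarMoment φ i j = haarMoment φ i i / 2 := by
  have h1 := haarMoment_self_eq φ (k := i) (s := 3 / 5) (t := -4 / 5) hij (reflectionUnitary hij)
    fun x => by
      rw [reflectionUnitary_mulVec]
      simp [Pi.single_eq_of_ne hij]
      ring
  have h2 := haarMoment_self_eq φ (k := j) (s := -4 / 5) (t := -3 / 5) hij (reflectionUnitary hij)
    fun x => by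
      rw [reflectionUnitary_mulVec]
      simp [Pi.single_eq_of_ne hij.symm]
      ring
  constructor <;> linarith

lemma haarMoment_eq {φ : ι → ℂ} (hφ : ∑ i, ‖φ i‖ ^ 2 = 1) (i j : ι) :
    haarMoment φ i j = (1 + if i = j then 1 else 0) /
      ((Fintype.card ι : ℝ) * (Fintype.card ι + 1)) := by
  have hself (k : ι) : haarMoment φ k k = haarMoment φ i i := by
    by_cases h : i = k
    · rw [h]
    · exact (haarMoment_of_ne φ h).1
  obtain ⟨q, hall⟩ : ∃ q, ∀ k l, haarMoment φ k l = q * (1 + if k = l then 1 else 0) := by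
    refine ⟨haarMoment φ i i / 2, fun k l => ?_⟩
    by_cases h : k = l
    · subst h
      rw [if_pos rfl, hself k]
      ring
    · rw [if_neg h, (haarMoment_of_ne φ h).2, hself k]
      ring
  -- The remaining scale q is fixed by averaging ‖ψ‖⁴ = 1.
  have hsum : ∑ k, ∑ l, haarMoment φ k l = 1 := by
    simp only [haarMoment]
    simp_rw [← integral_finsetSum _ fun l _ => integrable_haarMoment φ _ l]
    rw [← integral_finsetSum _ fun k _ =>
      integrable_finsetSum _ fun l _ => integrable_haarMoment φ k l]
    simp_rw [← Finset.mul_sum, ← Finset.sum_mul, sum_norm_unitary_mulVec_sq, hφ]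
    simp
  simp only [hall, ← Finset.mul_sum, Finset.sum_add_distrib, Finset.sum_ite_eq, Finset.mem_univ,
    if_true, Finset.sum_const, Finset.card_univ, nsmul_eq_mul, mul_one] at hsum
  have hc : (0 : ℝ) < Fintype.card ι := by exact_mod_cast Fintype.card_pos_iff.mpr ⟨i⟩
  rw [hall i j, eq_div_iff (by positivity)]
  linear_combination (1 + if i = j then 1 else 0) * hsum

/-- Coordinate i occurs exactly once, so flipping its sign negates the integrand. -/
lemma integral_unitary_mulVec_eq_zero (φ : ι → ℂ) {i j k l : ι} (hj : j ≠ i) (hk : k ≠ i)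
    (hl : l ≠ i) :
    ∫ U : unitaryGroup ι ℂ, (((U : Matrix ι ι ℂ) *ᵥ φ) i * star (((U : Matrix ι ι ℂ) *ᵥ φ) j) *
      (((U : Matrix ι ι ℂ) *ᵥ φ) k * star (((U : Matrix ι ι ℂ) *ᵥ φ) l))).re ∂haarUnitary ι = 0 := by
  have h := integral_unitary_mulVec φ (fun x => (x i * star (x j) * (x k * star (x l))).re)
    (phaseUnitary i (-1) (by simp))
  simp only [phaseUnitary_mulVec, if_true, if_neg hj, if_neg hk, if_neg hl, one_mul, neg_mul,
    Complex.neg_re, integral_neg] at h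
  linarith

end HaarMoments

/-! ### The reduced density matrix of a Haar-random state -/

section ReducedState

variable {κ γ : Type*} [Fintype κ] [Fintype γ]

omit [Fintype κ] in
lemma partialTraceSnd_ketBra_eq (ψ : EuclideanSpace ℂ (κ × γ)) :
    partialTraceSnd (ketBra ψ) =
      (Matrix.of fun a c => ψ (a, c)) * (Matrix.of fun a c => ψ (a, c))ᴴ := by
  ext a a'
  simp [partialTraceSnd, ketBra, vecMulVec_apply, mul_apply]

lemma posSemidef_partialTraceSnd_ketBra (ψ : EuclideanSpace ℂ (κ × γ)) :
    (partialTraceSnd (ketBra ψ)).PosSemidef := by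
  rw [partialTraceSnd_ketBra_eq]
  exact posSemidef_self_mul_conjTranspose _

variable [DecidableEq κ] [DecidableEq γ] {φ : EuclideanSpace ℂ (κ × γ)}

omit [DecidableEq κ] [DecidableEq γ] in
lemma sum_norm_sq_eq_one (hφ : ‖φ‖ = 1) : ∑ i, ‖φ i‖ ^ 2 = 1 := by
  rw [← EuclideanSpace.norm_sq_eq, hφ, one_pow]

lemma trace_partialTraceSnd_rotatedState (hφ : ‖φ‖ = 1) (U : unitaryGroup (κ × γ) ℂ) :
    (partialTraceSnd (ketBra (rotatedState φ U))).trace = 1 := by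
  rw [← Complex.ofReal_one, ← sum_norm_sq_eq_one hφ, ← sum_norm_unitary_mulVec_sq φ.ofLp U,
    Fintype.sum_prod_type, Complex.ofReal_sum]
  simp only [trace, diag, partialTraceSnd, ketBra, of_apply, vecMulVec_apply, Complex.ofReal_sum,
    Complex.ofReal_pow, ← Complex.mul_conj', Pi.star_apply, RCLike.star_def]
  rfl

lemma continuous_partialTraceSnd_rotatedState (φ : EuclideanSpace ℂ (κ × γ)) :
    Continuous fun U : unitaryGroup (κ × γ) ℂ => partialTraceSnd (ketBra (rotatedState φ U)) := by
  refine continuous_matrix fun a a' => ?_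
  exact continuous_finsetSum _ fun c _ => (continuous_unitary_mulVec_apply φ.ofLp (a, c)).mul
    (continuous_unitary_mulVec_apply φ.ofLp (a', c)).star

/-- The purity is a sum of fourth-order terms, of which only those with a = a' or c = c' survive
averaging. With d, K the two dimensions, the mean purity is (d + K)/(dK + 1). -/
lemma integral_purityExcess (hφ : ‖φ‖ = 1) :
    ∫ U, purityExcess (partialTraceSnd (ketBra (rotatedState φ U))) ∂haarUnitary (κ × γ) =
      ((Fintype.card κ : ℝ) ^ 2 - 1) / (Fintype.card κ * Fintype.card γ + 1) := by
  have hφ' := sum_norm_sq_eq_one hφ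
  have hne : Nonempty (κ × γ) := by
    by_contra h
    rw [not_nonempty_iff] at h
    simp at hφ'
  have hκ : (0 : ℝ) < Fintype.card κ := by
    exact_mod_cast Fintype.card_pos_iff.mpr (hne.map Prod.fst)
  have hγ : (0 : ℝ) < Fintype.card γ := by
    exact_mod_cast Fintype.card_pos_iff.mpr (hne.map Prod.snd)
  set T : κ → κ → γ → γ → unitaryGroup (κ × γ) ℂ → ℝ := fun a a' c c' U =>
    (((U : Matrix _ _ ℂ) *ᵥ φ.ofLp) (a, c) * star (((U : Matrix _ _ ℂ) *ᵥ φ.ofLp) (a', c)) *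
      (((U : Matrix _ _ ℂ) *ᵥ φ.ofLp) (a', c') *
        star (((U : Matrix _ _ ℂ) *ᵥ φ.ofLp) (a, c')))).re with hT
  have hTi (a a' c c') : Integrable (T a a' c c') (haarUnitary (κ × γ)) := by
    have h1 := continuous_unitary_mulVec_apply φ.ofLp (a, c)
    have h2 := continuous_unitary_mulVec_apply φ.ofLp (a', c)
    have h3 := continuous_unitary_mulVec_apply φ.ofLp (a', c')
    have h4 := continuous_unitary_mulVec_apply φ.ofLp (a, c')
    exact integrable_haarUnitary
      (Complex.continuous_re.comp ((h1.mul h2.star).mul (h3.mul h4.star)))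
  set q : ℝ := ((Fintype.card (κ × γ) : ℝ) * (Fintype.card (κ × γ) + 1))⁻¹ with hq
  have hTval (a a' c c') : ∫ U, T a a' c c' U ∂haarUnitary (κ × γ) =
      q * ((if a = a' then 1 else 0) + if c = c' then 1 else 0) := by
    by_cases ha : a = a'
    · subst ha
      have : ∫ U, T a a c c' U ∂haarUnitary (κ × γ) = haarMoment φ.ofLp (a, c) (a, c') :=
        integral_congr_ae (ae_of_all _ fun U => by
          simp only [hT, RCLike.star_def, Complex.mul_conj']
          norm_cast)
      rw [this, haarMoment_eq hφ', if_pos rfl, hq, inv_mul_eq_div]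
      simp
    · by_cases hc : c = c'
      · subst hc
        have : ∫ U, T a a' c c U ∂haarUnitary (κ × γ) = haarMoment φ.ofLp (a, c) (a', c) :=
          integral_congr_ae (ae_of_all _ fun U => by
            have (x y : ℂ) : (x * star y * (y * star x)).re = ‖x‖ ^ 2 * ‖y‖ ^ 2 := by
              rw [mul_assoc, ← mul_assoc (star y), mul_comm _ (star x), ← mul_assoc,
                RCLike.star_def, Complex.mul_conj', Complex.conj_mul']
              norm_cast
            exact this _ _)
        rw [this, haarMoment_eq hφ', if_neg ha, if_pos rfl, hq, inv_mul_eq_div]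
        simp [ha]
      · rw [if_neg ha, if_neg hc]
        simp only [add_zero, mul_zero]
        refine integral_unitary_mulVec_eq_zero φ.ofLp ?_ ?_ ?_ <;>
          simp [Ne.symm ha, Ne.symm hc]
  have hpur (U : unitaryGroup (κ × γ) ℂ) :
      purityExcess (partialTraceSnd (ketBra (rotatedState φ U))) =
        Fintype.card κ * (∑ a, ∑ a', ∑ c, ∑ c', T a a' c c' U) - 1 := by
    rw [purityExcess]
    congr 2
    simp only [trace, diag, mul_apply, partialTraceSnd, ketBra, of_apply, vecMulVec_apply,
      Finset.sum_mul_sum, Complex.re_sum]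
    rfl
  have hTsum : ∫ U, (∑ a, ∑ a', ∑ c, ∑ c', T a a' c c' U) ∂haarUnitary (κ × γ) =
      q * (Fintype.card κ * Fintype.card γ ^ 2 + Fintype.card κ ^ 2 * Fintype.card γ) := by
    rw [integral_finsetSum _ fun a _ => integrable_finsetSum _ fun a' _ =>
      integrable_finsetSum _ fun c _ => integrable_finsetSum _ fun c' _ => hTi a a' c c']
    simp_rw [integral_finsetSum _ fun a' _ => integrable_finsetSum _ fun c _ =>
      integrable_finsetSum _ fun c' _ => hTi _ a' c c']
    simp_rw [integral_finsetSum _ fun c _ => integrable_finsetSum _ fun c' _ => hTi _ _ c c']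
    simp_rw [integral_finsetSum _ fun c' _ => hTi _ _ _ c']
    simp only [hTval, ← Finset.mul_sum, Finset.sum_add_distrib, Finset.sum_ite_eq, Finset.mem_univ,
      if_true, Finset.sum_const, Finset.card_univ, nsmul_eq_mul, mul_one]
    ring
  simp_rw [hpur]
  rw [integral_sub, integral_const_mul, hTsum, hq, Fintype.card_prod]
  · simp
    field_simp
    ring
  · exact (integrable_finsetSum _ fun a _ => integrable_finsetSum _ fun a' _ =>
      integrable_finsetSum _ fun c _ => integrable_finsetSum _ fun c' _ =>
        hTi a a' c c').const_mul _
  · exact integrable_const _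

end ReducedState

/-- The ratio is already at most d/K; the square root only weakens this, as d/K ≤ 1. -/
lemma sq_sub_one_div_le_rpow_half {d K : ℝ} (hd : 0 < d) (hK : d ≤ K) :
    (d ^ 2 - 1) / (d * K + 1) ≤ (d / K) ^ (1 / 2 : ℝ) := by
  have hK0 : 0 < K := hd.trans_le hK
  have h1 : (d ^ 2 - 1) / (d * K + 1) ≤ d / K := by
    rw [div_le_div_iff₀ (by positivity) hK0]
    nlinarith
  have h2 : d / K ≤ 1 := (div_le_one hK0).mpr hK
  calc (d ^ 2 - 1) / (d * K + 1) ≤ (d / K) ^ (1 : ℝ) := by rwa [Real.rpow_one]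
    _ ≤ _ := Real.rpow_le_rpow_of_exponent_ge (by positivity) h2 (by norm_num)

end ReflectedEntropyBounds

theorem lemma2 (χA χB χC : ℕ) (hχ : χA * χB ≤ χC)
    (φ₀ : EuclideanSpace ℂ ((Fin χA × Fin χB) × Fin χC)) (hφ₀ : ‖φ₀‖ = 1)
    (m : ℝ) (hm₁ : 1 ≤ m) (hm₂ : m ≤ 2) :
    (∀ n : ℝ, 1 < n →
      Integrable (fun U => tripartiteReflectedEntropy m n (rotatedState φ₀ U))
        (haarUnitary ((Fin χA × Fin χB) × Fin χC)) ∧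
      ∫ U, tripartiteReflectedEntropy m n (rotatedState φ₀ U)
          ∂(haarUnitary ((Fin χA × Fin χB) × Fin χC)) ≤
        2 * n / (n - 1) * ((χA : ℝ) * χB / χC) ^ (1 / 2 : ℝ) *
          min ((χA : ℝ) ^ (2 * (n - 1))) ((χB : ℝ) ^ (2 * (n - 1)))) ∧
    (Integrable (fun U => tripartiteReflectedEntropy m 1 (rotatedState φ₀ U))
        (haarUnitary ((Fin χA × Fin χB) × Fin χC)) ∧
      ∫ U, tripartiteReflectedEntropy m 1 (rotatedState φ₀ U)
          ∂(haarUnitary ((Fin χA × Fin χB) × Fin χC)) ≤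
        2 * ((χA : ℝ) * χB / χC) ^ (1 / 2 : ℝ) * min (Real.log χA) (Real.log χB) +
          Real.log 2) := by
  set ρ := fun U : unitaryGroup ((Fin χA × Fin χB) × Fin χC) ℂ =>
    partialTraceSnd (ketBra (rotatedState φ₀ U)) with hρ
  have hpos (U) := posSemidef_partialTraceSnd_ketBra (rotatedState φ₀ U)
  have htr (U) : (ρ U).trace = 1 := trace_partialTraceSnd_rotatedState hφ₀ U
  have hcont : Continuous ρ := continuous_partialTraceSnd_rotatedState φ₀
  have hm : 0 < m := by linarith
  have hint {n : ℝ} (hn : 1 ≤ n) :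
      Integrable (fun U => tripartiteReflectedEntropy m n (rotatedState φ₀ U))
        (haarUnitary ((Fin χA × Fin χB) × Fin χC)) :=
    integrable_haarUnitary (continuous_renyiReflectedEntropy hcont hpos htr hm hn)
  -- Positivity of the dimensions comes from the existence of a unit vector.
  have hne : Nonempty ((Fin χA × Fin χB) × Fin χC) := by
    by_contra h
    rw [not_nonempty_iff] at h
    simpa using sum_norm_sq_eq_one hφ₀
  obtain ⟨⟨a, b⟩, -⟩ := hne
  have hA : 1 ≤ χA := a.pos
  have hB : 1 ≤ χB := b.pos
  have hδi : Integrable (fun U => purityExcess (ρ U))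
      (haarUnitary ((Fin χA × Fin χB) × Fin χC)) := by
    refine integrable_haarUnitary ?_
    exact (continuous_const.mul (Complex.continuous_re.comp
      (hcont.matrix_mul hcont).matrix_trace)).sub continuous_const
  have hδ : ∫ U, purityExcess (ρ U) ∂haarUnitary ((Fin χA × Fin χB) × Fin χC) ≤
      ((χA : ℝ) * χB / χC) ^ (1 / 2 : ℝ) := by
    rw [integral_purityExcess hφ₀]
    simp only [Fintype.card_prod, Fintype.card_fin, Nat.cast_mul]
    exact sq_sub_one_div_le_rpow_half (by positivity) (by exact_mod_cast hχ)
  set ε := ((χA : ℝ) * χB / χC) ^ (1 / 2 : ℝ) with hε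
  have hε0 : 0 ≤ ε := by positivity
  have hrank (U) : (reflectedDensity m (ρ U)).rank ≤ χA ^ 2 ∧
      (reflectedDensity m (ρ U)).rank ≤ χB ^ 2 := by
    simpa only [Fintype.card_fin] using rank_reflectedDensity_le (m := m) (ρ := ρ U)
  have hrenyi {n : ℝ} (hn : 1 < n) {k : ℕ}
      (hk : ∀ U, (reflectedDensity m (ρ U)).rank ≤ k ^ 2) :
      ∫ U, tripartiteReflectedEntropy m n (rotatedState φ₀ U)
          ∂(haarUnitary ((Fin χA × Fin χB) × Fin χC)) ≤
        2 * n / (n - 1) * ε * (k : ℝ) ^ (2 * (n - 1)) := by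
    have hn0 : 0 < n - 1 := by linarith
    have hn1 : 0 < n := by linarith
    calc _ ≤ ∫ U, n / (n - 1) * (k : ℝ) ^ (2 * (n - 1)) * purityExcess (ρ U)
          ∂(haarUnitary ((Fin χA × Fin χB) × Fin χC)) :=
        integral_mono (hint hn.le) (hδi.const_mul _) fun U =>
          renyiReflectedEntropy_le (hpos U) (htr U) hm₁ hm₂ hn (hk U)
      _ ≤ n / (n - 1) * (k : ℝ) ^ (2 * (n - 1)) * ε := by
        rw [integral_const_mul]
        gcongr
      -- The factor 2 in the Rényi bound is pure slack.
      _ ≤ 2 * (n / (n - 1) * (k : ℝ) ^ (2 * (n - 1)) * ε) := by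
        have : 0 ≤ n / (n - 1) * (k : ℝ) ^ (2 * (n - 1)) * ε := by positivity
        linarith
      _ = _ := by ring
  have hvn {k : ℕ} (hk0 : 1 ≤ k) (hk : ∀ U, (reflectedDensity m (ρ U)).rank ≤ k ^ 2) :
      ∫ U, tripartiteReflectedEntropy m 1 (rotatedState φ₀ U)
          ∂(haarUnitary ((Fin χA × Fin χB) × Fin χC)) ≤
        2 * ε * Real.log k + Real.log 2 := by
    have hlog : 0 ≤ Real.log k := Real.log_natCast_nonneg k
    calc _ ≤ ∫ U, (2 * Real.log k * purityExcess (ρ U) + Real.log 2)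
          ∂(haarUnitary ((Fin χA × Fin χB) × Fin χC)) :=
        integral_mono (hint le_rfl) ((hδi.const_mul _).add (integrable_const _)) fun U =>
          renyiReflectedEntropy_one_le (hpos U) (htr U) hm₁ hm₂ hk0 (hk U)
      _ = 2 * Real.log k * ∫ U, purityExcess (ρ U)
          ∂(haarUnitary ((Fin χA × Fin χB) × Fin χC)) + Real.log 2 := by
        rw [integral_add (hδi.const_mul _) (integrable_const _), integral_const_mul]
        simp
      _ ≤ 2 * Real.log k * ε + Real.log 2 := by gcongr
      _ = _ := by ring
  refine ⟨fun n hn => ⟨hint hn.le, ?_⟩, hint le_rfl, ?_⟩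
  · rcases min_choice ((χA : ℝ) ^ (2 * (n - 1))) ((χB : ℝ) ^ (2 * (n - 1))) with h | h <;> rw [h]
    exacts [hrenyi hn fun U => (hrank U).1, hrenyi hn fun U => (hrank U).2]
  · rcases min_choice (Real.log χA) (Real.log χB) with h | h <;> rw [h]
    exacts [hvn hA fun U => (hrank U).1, hvn hB fun U => (hrank U).2]
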